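/- Let $\mathbb F$ be a field of characteristic $0$, let $\phi,\psi\in\mathbb F[w]$ be polynomials with $\deg\phi\le 7$ and $\deg\psi\le 3$, and suppose that $$f(x,y)=x^{14}+y^{14}+\phi(xy)+(x^7-y^7)\,\psi(xy)$$ is irreducible in $\mathbb F[x,y]$. Let $X$ be the curve with function field $K=\mathbb F(x,y)$, $f(x,y)=0$, and put $w=xy$, $\tau=x^7-y^7$ in $K$. If $\zeta\in\mathbb F$ is a primitive $7$th root of unity, the dihedral group $D_7$ of order $14$ acts on $K$ over $\mathbb F$ through $s(x)=\zeta x$, $s(y)=\zeta^{-1}y$, $t(x)=-y$, $t(y)=-x$, and the function field of $X/D_7$ is the fixed field $K^{D_7}$. Then $K^{D_7}=\mathbb F(\tau,w)$ for every such $\zeta\in\mathbb F$ (and if $\mathbb F$ contains no such $\zeta$, $X/D_7$ denotes the curve with function field $\mathbb F(\tau,w)$). The ideal of all polynomial relations over $\mathbb F$ between $\tau$ and $w$ is generated by $\tau^2+\tau\psi(w)+\phi(w)+2w^7$. Moreover, writing $D(w)=\psi(w)^2-4(\phi(w)+2w^7)$ and taking the genus to be the dimension over $\mathbb F$ of the space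 of regular differentials: (a) if $D(w)=L(w)C(w)^2$ for some $L,C\in\mathbb F[w]$ with $\deg L\le 1$ and $\deg C\le 3$, then $X/D_7$ has genus $0$; (b) conversely, if $D$ has odd degree (for instance if $D$ has degree $7$, i.e. the coefficient of $w^7$ in $\phi$ is not $-2$) and $X/D_7$ has genus $0$, then $D(w)=L(w)C(w)^2$ for some $L,C\in\mathbb F[w]$ with $\deg L\le 1$ and $\deg C\le 3$. In particular, when $D$ has odd degree, $X/D_7$ has genus $0$ if and only if $D=LC^2$ with $\deg L\le1$ and $\deg C\le 3$. -/

import Mathlib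

open scoped IntermediateField

noncomputable section

namespace DihedralCurve

/-! ### Genus of a function field of one variable in characteristic zero -/

/-- The `F`-space of regular (holomorphic) differentials of a field extension `K / F`. The valuation
rings of `K` containing `F` are the local rings of the smooth projective model of `K` (and `K`
itself, which imposes no condition). A differential is regular at the point with local ring `O` when
it lies in the `O`-submodule of `Ω[K⁄F]` generated by the `da`, `a ∈ O`, that is, in the image
of `Ω[O⁄F]`. -/
def regularDifferentials (F K : Type*) [Field F] [Field K] [Algebra F K] :
    Submodule F (Ω[K⁄F]) where
  carrier := {ω | ∀ O : ValuationSubring K, (∀ c : F, algebraMap F K c ∈ O) →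
    ω ∈ Submodule.span O ((fun a : K => KaehlerDifferential.D F K a) '' (O : Set K))}
  add_mem' := fun h₁ h₂ O hO => Submodule.add_mem _ (h₁ O hO) (h₂ O hO)
  zero_mem' := fun _ _ => Submodule.zero_mem _
  smul_mem' := fun c ω h O hO => by
    have e : c • ω = (⟨algebraMap F K c, hO c⟩ : O) • ω := (algebraMap_smul K c ω).symm
    rw [e]
    exact Submodule.smul_mem _ _ (h O hO)

/-- The (geometric) genus of a function field `K` of one variable over a field `F` of
characteristic zero: the dimension over `F` of its space of regular differentials. -/
def genus (F K : Type*) [Field F] [Field K] [Algebra F K] : ℕ∞ :=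
  Cardinal.toENat (Module.rank F (regularDifferentials F K))

/-! ### The curve `X` and its function field -/

section Curve

variable {F : Type*} [Field F]

/-- `f(x, y) = x ^ 14 + y ^ 14 + φ(xy) + (x ^ 7 - y ^ 7) ψ(xy)`. -/
def curvePoly (φ ψ : Polynomial F) : MvPolynomial (Fin 2) F :=
  MvPolynomial.X 0 ^ 14 + MvPolynomial.X 1 ^ 14
    + Polynomial.aeval (MvPolynomial.X 0 * MvPolynomial.X 1) φ
    + (MvPolynomial.X 0 ^ 7 - MvPolynomial.X 1 ^ 7)
      * Polynomial.aeval (MvPolynomial.X 0 * MvPolynomial.X 1) ψ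

/-- The affine coordinate ring `F[x, y] / (f)`. -/
abbrev CoordRing (φ ψ : Polynomial F) : Type _ :=
  MvPolynomial (Fin 2) F ⧸ Ideal.span {curvePoly φ ψ}

instance (φ ψ : Polynomial F) [h : Fact (Irreducible (curvePoly φ ψ))] :
    IsDomain (CoordRing φ ψ) :=
  (Ideal.Quotient.isDomain_iff_prime _).2
    ((Ideal.span_singleton_prime h.out.ne_zero).2 h.out.prime)

/-- The function field `K = F(x, y)`, `f(x, y) = 0`, of the curve `X`. -/
abbrev FunField (φ ψ : Polynomial F) : Type _ :=
  FractionRing (CoordRing φ ψ)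

/-- The automorphism `x ↦ ζ x`, `y ↦ ζ⁻¹ y` of `F[x, y]`. -/
def polyS (ζ : F) (hζ : ζ ≠ 0) : MvPolynomial (Fin 2) F ≃ₐ[F] MvPolynomial (Fin 2) F :=
  AlgEquiv.ofAlgHom
    (MvPolynomial.aeval ![MvPolynomial.C ζ * MvPolynomial.X 0, MvPolynomial.C ζ⁻¹ * MvPolynomial.X 1])
    (MvPolynomial.aeval ![MvPolynomial.C ζ⁻¹ * MvPolynomial.X 0, MvPolynomial.C ζ * MvPolynomial.X 1])
    (by
      ext i : 1
      fin_cases i <;> simp [MvPolynomial.algHom_C, ← mul_assoc, ← MvPolynomial.C_mul, hζ])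
    (by
      ext i : 1
      fin_cases i <;> simp [MvPolynomial.algHom_C, ← mul_assoc, ← MvPolynomial.C_mul, hζ])

/-- The automorphism `x ↦ -y`, `y ↦ -x` of `F[x, y]`. -/
def polyT : MvPolynomial (Fin 2) F ≃ₐ[F] MvPolynomial (Fin 2) F :=
  AlgEquiv.ofAlgHom
    (MvPolynomial.aeval ![-MvPolynomial.X 1, -MvPolynomial.X 0])
    (MvPolynomial.aeval ![-MvPolynomial.X 1, -MvPolynomial.X 0])
    (by ext i : 1; fin_cases i <;> simp)
    (by ext i : 1; fin_cases i <;> simp)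

theorem polyS_curvePoly (φ ψ : Polynomial F) {ζ : F} (hζ : IsPrimitiveRoot ζ 7) :
    polyS ζ (hζ.ne_zero (by norm_num)) (curvePoly φ ψ) = curvePoly φ ψ := by
  have h0 : ζ ≠ 0 := hζ.ne_zero (by norm_num)
  have hx : polyS ζ h0 (MvPolynomial.X 0) = MvPolynomial.C ζ * MvPolynomial.X 0 := by simp [polyS]
  have hy : polyS ζ h0 (MvPolynomial.X 1) = MvPolynomial.C ζ⁻¹ * MvPolynomial.X 1 := by
    simp [polyS]
  have hc : (MvPolynomial.C ζ : MvPolynomial (Fin 2) F) * MvPolynomial.C ζ⁻¹ = 1 := by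
    rw [← MvPolynomial.C_mul, mul_inv_cancel₀ h0, MvPolynomial.C_1]
  have hw : (MvPolynomial.C ζ * MvPolynomial.X 0) * (MvPolynomial.C ζ⁻¹ * MvPolynomial.X 1)
      = (MvPolynomial.X 0 * MvPolynomial.X 1 : MvPolynomial (Fin 2) F) := by
    linear_combination (MvPolynomial.X 0 * MvPolynomial.X 1) * hc
  have h7 : (MvPolynomial.C ζ : MvPolynomial (Fin 2) F) ^ 7 = 1 := by
    rw [← MvPolynomial.C_pow, hζ.pow_eq_one, MvPolynomial.C_1]
  have h7' : (MvPolynomial.C ζ⁻¹ : MvPolynomial (Fin 2) F) ^ 7 = 1 := by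
    rw [← MvPolynomial.C_pow, inv_pow, hζ.pow_eq_one, inv_one, MvPolynomial.C_1]
  have h14 : (MvPolynomial.C ζ : MvPolynomial (Fin 2) F) ^ 14 = 1 := by
    rw [show 14 = 7 * 2 from rfl, pow_mul, h7, one_pow]
  have h14' : (MvPolynomial.C ζ⁻¹ : MvPolynomial (Fin 2) F) ^ 14 = 1 := by
    rw [show 14 = 7 * 2 from rfl, pow_mul, h7', one_pow]
  simp only [curvePoly, map_add, map_sub, map_mul, map_pow, ← Polynomial.aeval_algHom_apply, hx, hy,
    hw, mul_pow, h7, h7', h14, h14', one_mul]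

theorem polyT_curvePoly (φ ψ : Polynomial F) :
    polyT (curvePoly φ ψ) = curvePoly φ ψ := by
  have hx : polyT (MvPolynomial.X 0 : MvPolynomial (Fin 2) F) = -MvPolynomial.X 1 := by
    simp [polyT]
  have hy : polyT (MvPolynomial.X 1 : MvPolynomial (Fin 2) F) = -MvPolynomial.X 0 := by
    simp [polyT]
  have hw : (-MvPolynomial.X 1) * (-MvPolynomial.X 0)
      = (MvPolynomial.X 0 * MvPolynomial.X 1 : MvPolynomial (Fin 2) F) := by ring
  simp only [curvePoly, map_add, map_sub, map_mul, map_pow, ← Polynomial.aeval_algHom_apply, hx, hy,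
    hw]
  ring

variable (φ ψ : Polynomial F) [Fact (Irreducible (curvePoly φ ψ))]

/-- The function `x` on `X`. -/
def x : FunField φ ψ :=
  algebraMap (CoordRing φ ψ) _ (Ideal.Quotient.mk _ (MvPolynomial.X 0))

/-- The function `y` on `X`. -/
def y : FunField φ ψ :=
  algebraMap (CoordRing φ ψ) _ (Ideal.Quotient.mk _ (MvPolynomial.X 1))

/-- `w = xy`. -/
def w : FunField φ ψ := x φ ψ * y φ ψ

/-- `τ = x ^ 7 - y ^ 7`. -/
def τ : FunField φ ψ := x φ ψ ^ 7 - y φ ψ ^ 7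

/-- An automorphism of `F[x, y]` fixing `f` induces an automorphism of the function field. -/
def inducedAut (e : MvPolynomial (Fin 2) F ≃ₐ[F] MvPolynomial (Fin 2) F)
    (he : e (curvePoly φ ψ) = curvePoly φ ψ) : FunField φ ψ ≃ₐ[F] FunField φ ψ :=
  IsFractionRing.fieldEquivOfAlgEquiv F (FunField φ ψ) (FunField φ ψ)
    (Ideal.quotientEquivAlg (Ideal.span {curvePoly φ ψ}) (Ideal.span {curvePoly φ ψ}) e
      (by rw [Ideal.map_span, Set.image_singleton]; exact congrArg (fun p => Ideal.span {p}) he.symm))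

/-- The automorphism `s` of `K`: `x ↦ ζ x`, `y ↦ ζ⁻¹ y`. -/
def autS {ζ : F} (hζ : IsPrimitiveRoot ζ 7) : FunField φ ψ ≃ₐ[F] FunField φ ψ :=
  inducedAut φ ψ (polyS ζ (hζ.ne_zero (by norm_num))) (polyS_curvePoly φ ψ hζ)

/-- The automorphism `t` of `K`: `x ↦ -y`, `y ↦ -x`. -/
def autT : FunField φ ψ ≃ₐ[F] FunField φ ψ :=
  inducedAut φ ψ polyT (polyT_curvePoly φ ψ)

/-- The dihedral group `D₇` of automorphisms of `X`, generated by `s` and `t`. -/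
def D₇ {ζ : F} (hζ : IsPrimitiveRoot ζ 7) : Subgroup (FunField φ ψ ≃ₐ[F] FunField φ ψ) :=
  Subgroup.closure {autS φ ψ hζ, autT φ ψ}

/-- The function field of `X/D₇`: the subfield of `K` fixed by `D₇`. -/
def quotientField {ζ : F} (hζ : IsPrimitiveRoot ζ 7) : IntermediateField F (FunField φ ψ) :=
  IntermediateField.fixedField (D₇ φ ψ hζ)

end Curve

/-- `ψ ^ 2 - 4 (φ + 2 w ^ 7)`, the discriminant in `τ` of `τ ^ 2 + τ ψ(w) + φ(w) + 2 w ^ 7`. -/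
def disc {F : Type*} [Field F] (φ ψ : Polynomial F) : Polynomial F :=
  ψ ^ 2 - 4 * (φ + 2 * Polynomial.X ^ 7)

end DihedralCurve

end

/-!
Write `w = xy`, `τ = x ^ 7 - y ^ 7`. Since `x ^ 14 + y ^ 14 = τ ^ 2 + 2 w ^ 7`, the equation `f = 0`
reads `τ ^ 2 + τ ψ(w) + φ(w) + 2 w ^ 7 = 0`, that is `v ^ 2 = D(w)` with `v = 2 τ + ψ(w)` and `D` the
discriminant.

*Relations.* Restricting to the coordinate axes, where `f` has degree `14`, shows that `w` is
transcendental (`transcendental_w`). If `D` were a square, `f` would factor (`disc_ne_sq`); hence `1`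
and `τ` are independent over `F(w)`, and division by the quadratic, monic in `τ`, computes the ideal
of relations (`ker_aeval_τ_w`).

*Fixed field.* `K = F(τ, w)(x)`, where `x` is a root of `Z ^ 14 - τ Z ^ 7 - w ^ 7`, so `K` has degree
at most `14` over `F(τ, w)`. The fixed field contains `F(τ, w)`, and over it `x` has the `14` distinct
conjugates `ζ ^ i x`, `- ζ ^ i y`. So the two fields agree (`quotientField_eq_adjoin`).

*Genus.* If `D = L C ^ 2` with `L` of degree at most one, put `u = v / C(w)`, so that `u ^ 2 = L(w)`.
Then the field is `E(z)` with `E` algebraic over `F`: either `z = u`, or `L` is constant, `E = F(u)` and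
`z = w`. Such a field has no regular differentials (`regularDifferentials_eq_bot`): regularity at the
primes of `E[z]` leaves only the forms `p(z) dz` with `p` a polynomial, and these have a pole at
infinity unless `p = 0`. Conversely write `D = S C ^ 2` with `S` squarefree. If `D` has odd degree, so
has `S`, and if `S` has degree at least `3` then `dw / u` with `u ^ 2 = S(w)` is regular everywhere
(`inv_smul_D_mem_regularDifferentials`). It is nonzero because `dw ≠ 0` in characteristic zero
(`D_ne_zero_of_transcendental`).
-/

noncomputable section

namespace DihedralCurve

/-! ### Differentials of a function field of one variable -/

section Differentials

open Polynomial KaehlerDifferential IsDedekindDomain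

variable {F K : Type*} [Field F] [Field K] [Algebra F K]

theorem genus_eq_zero_iff : genus F K = 0 ↔ regularDifferentials F K = ⊥ := by
  rw [genus, Cardinal.toENat_eq_zero, Submodule.rank_eq_zero]

/-- Differentiate the equation given by the minimal polynomial, which is separable. -/
theorem D_eq_zero_of_isAlgebraic [CharZero F] {a : K} (ha : IsAlgebraic F a) : D F K a = 0 := by
  have h : aeval a (minpoly F a).derivative • D F K a = 0 := by
    rw [← Derivation.map_aeval, minpoly.aeval, map_zero]
  exact (smul_eq_zero.1 h).resolve_left
    ((minpoly.irreducible ha.isIntegral).separable.aeval_derivative_ne_zero (minpoly.aeval F a))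

/-- Elements algebraic over `F` are constants for `D F K`, so the chain rule holds for polynomials
with coefficients in an algebraic extension of `F`. -/
theorem D_aeval_of_isAlgebraic [CharZero F] {E : Type*} [Field E] [Algebra F E] [Algebra E K]
    [IsScalarTower F E K] [Algebra.IsAlgebraic F E] (z : K) (p : E[X]) :
    D F K (aeval z p) = aeval z p.derivative • D F K z := by
  have hc (e : E) : D F K (algebraMap E K e) = 0 :=
    D_eq_zero_of_isAlgebraic ((Algebra.IsAlgebraic.isAlgebraic e).algebraMap)
  induction p using Polynomial.induction_on' with
  | add p q hp hq => simp [hp, hq, add_smul]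
  | monomial n e =>
    rw [derivative_monomial, aeval_monomial, aeval_monomial, Derivation.leibniz, hc,
      Derivation.leibniz_pow, smul_zero, add_zero, ← Nat.cast_smul_eq_nsmul K n, smul_smul, smul_smul,
      map_mul, map_natCast]

theorem isFractionRing_aeval {E K : Type*} [Field E] [Field K] [Algebra E K] {z : K}
    (hz : Transcendental E z) (htop : E⟮z⟯ = ⊤) :
    letI : Algebra E[X] K := (aeval z).toAlgebra
    IsFractionRing E[X] K := by
  let : Algebra E[X] K := (aeval z).toAlgebra
  have : FaithfulSMul E[X] K := (faithfulSMul_iff_algebraMap_injective _ _).2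
    (transcendental_iff_injective.1 hz)
  refine IsFractionRing.of_field _ _ fun a => ?_
  exact (IntermediateField.mem_adjoin_simple_iff E a).1 (htop ▸ IntermediateField.mem_top)

theorem mem_valuationSubring_of_algebraMap {E : Type*} [Field E] [Algebra F E] [Algebra E K]
    [IsScalarTower F E K] [Algebra E[X] K]
    [IsScalarTower E E[X] K] [IsFractionRing E[X] K] (v : HeightOneSpectrum E[X]) (c : F) :
    algebraMap F K c ∈ (v.valuation K).valuationSubring := by
  rw [IsScalarTower.algebraMap_apply F E K, IsScalarTower.algebraMap_apply E E[X] K]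
  exact v.valuation_le_one _

/-- If `w` is transcendental over `F` and `K` is algebraic over `F(w)`, then `dw ≠ 0` in
characteristic zero: `K` is formally étale over `F[w]`, so `Ω[K⁄F]` is the base change of
`Ω[F[w]⁄F]`. -/
theorem D_ne_zero_of_transcendental [CharZero F] {w : K} (hw : Transcendental F w)
    [Algebra.IsAlgebraic F⟮w⟯ K] : D F K w ≠ 0 := by
  have hinj := transcendental_iff_injective.1 hw
  let w' : F⟮w⟯ := IntermediateField.AdjoinSimple.gen F w
  let : Algebra F[X] F⟮w⟯ := (aeval w').toAlgebra
  let : Algebra F[X] K := (aeval w).toAlgebra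
  have hm (p : F[X]) : algebraMap F[X] F⟮w⟯ p = aeval w' p := rfl
  have hm' (p : F[X]) : algebraMap F[X] K p = aeval w p := rfl
  have hmm (p : F[X]) : ((aeval w' p : F⟮w⟯) : K) = aeval w p := by
    have := aeval_algebraMap_apply K w' p
    exact this.symm
  have : IsScalarTower F[X] F⟮w⟯ K := .of_algebraMap_eq fun p => (hmm p).symm
  have : IsScalarTower F F[X] K := .of_algebraMap_eq fun c => by simp [hm']
  have : FaithfulSMul F[X] F⟮w⟯ := (faithfulSMul_iff_algebraMap_injective _ _).2 fun p q h =>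
    hinj (by simp only [hm] at h; simpa only [hmm] using congrArg (Subtype.val) h)
  have : IsFractionRing F[X] F⟮w⟯ := by
    refine IsFractionRing.of_field _ _ fun z => ?_
    obtain ⟨r, s, h⟩ := (IntermediateField.mem_adjoin_simple_iff F _).1 z.2
    exact ⟨r, s, Subtype.ext (by simp [hm, hmm, h])⟩
  have : Algebra.FormallyEtale F[X] F⟮w⟯ := .of_isLocalization (nonZeroDivisors _)
  have : Algebra.FormallyEtale F⟮w⟯ K := .of_isSeparable _ _
  have : Algebra.FormallyEtale F[X] K := .comp _ F⟮w⟯ _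
  intro h
  have h1 := tensorKaehlerEquivOfFormallyEtale_symm_D_algebraMap F F[X] K X
  rw [hm', aeval_X, h, map_zero] at h1
  have h2 := congrArg (LinearMap.lTensor K (polynomialEquiv F).toLinearMap) h1
  rw [map_zero, LinearMap.lTensor_tmul, LinearEquiv.coe_coe, polynomialEquiv_D,
    derivative_X] at h2
  have h3 := congrArg (TensorProduct.rid F[X] K) h2
  simp at h3

end Differentials

/-! ### Rational function fields have no regular differentials -/

section Rational

open Polynomial KaehlerDifferential IsDedekindDomain

variable {F E K : Type*} [Field F] [Field E] [Field K] [Algebra F K] [Algebra F E] [Algebra E K]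
  [IsScalarTower F E K] [Algebra.IsAlgebraic F E] [CharZero F]

/-- At the place of `E(z)` given by a prime of `E[z]`, a differential `g dz` is regular only if
`g` is: every element `n / d` of the local ring has derivative `(n' d - n d') / d ^ 2` there. -/
theorem valuation_le_one_of_mem_span [Algebra E[X] K] [IsScalarTower E E[X] K]
    [IsFractionRing E[X] K] (v : HeightOneSpectrum E[X]) {z : K} (hz : algebraMap E[X] K X = z)
    (hdz : D F K z ≠ 0) {g : K}
    (h : g • D F K z ∈ Submodule.span (v.valuation K).valuationSubring
      ((fun a : K => D F K a) '' ((v.valuation K).valuationSubring : Set K))) :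
    v.valuation K g ≤ 1 := by
  have hm (p : E[X]) : algebraMap E[X] K p = aeval z p := by
    rw [← hz, aeval_algebraMap_apply, aeval_X_left_apply]
  have hspan : Submodule.span (v.valuation K).valuationSubring
      ((fun a : K => D F K a) '' ((v.valuation K).valuationSubring : Set K)) ≤
      Submodule.span (v.valuation K).valuationSubring {D F K z} := by
    rw [Submodule.span_le]
    rintro _ ⟨a, ha, rfl⟩
    obtain ⟨n, ⟨d, hd⟩, h⟩ := v.exists_primeCompl_mul_eq_of_integer a ha
    have hvd : v.valuation K (aeval z d) = 1 := by
      rw [← hm]; exact (HeightOneSpectrum.valuation_eq_one_iff_notMem v).2 hd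
    have hd0 : aeval z d ≠ 0 := fun h0 => by simp [h0] at hvd
    simp only [hm] at h
    have hv (p : E[X]) : v.valuation K (aeval z p) ≤ 1 := by rw [← hm]; exact v.valuation_le_one p
    -- differentiate `a * d = n`
    have hD := congrArg (D F K) h
    rw [Derivation.leibniz, D_aeval_of_isAlgebraic, D_aeval_of_isAlgebraic] at hD
    refine Submodule.mem_span_singleton.2 ⟨⟨(aeval z n.derivative - a * aeval z d.derivative)
      / aeval z d, ?_⟩, ?_⟩
    · rw [Valuation.mem_valuationSubring_iff, map_div₀, hvd, div_one]
      refine (Valuation.map_sub _ _ _).trans (max_le (hv _) ?_)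
      rw [map_mul]
      exact mul_le_one' ha (hv _)
    · change ((aeval z n.derivative - a * aeval z d.derivative) / aeval z d) • D F K z = D F K a
      have h2 : aeval z d • D F K a =
          (aeval z n.derivative - a * aeval z d.derivative) • D F K z := by
        rw [sub_smul, ← hD, mul_smul]; abel
      rw [div_eq_inv_mul, mul_smul, ← h2, smul_smul, inv_mul_cancel₀ hd0, one_smul]
  obtain ⟨⟨c, hc⟩, h⟩ := Submodule.mem_span_singleton.1 (hspan h)
  have : c = g := smul_left_injective K hdz h
  exact this ▸ hc

/-- A field `E(z)`, with `z` transcendental over an algebraic extension `E` of `F`, has no nonzero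
regular differentials over `F`: regularity at the primes of `E[z]` forces `ω = p(z) dz` with a
polynomial `p`, and such a form has a pole at infinity. -/
theorem regularDifferentials_eq_bot {z : K} (hz : Transcendental E z) (htop : E⟮z⟯ = ⊤) :
    regularDifferentials F K = ⊥ := by
  have hz0 : z ≠ 0 := fun h => hz (h ▸ isAlgebraic_zero)
  have hspan (ω : Ω[K⁄F]) : ∃ g : K, g • D F K z = ω := by
    rw [← Submodule.mem_span_singleton]
    suffices h : ⊤ ≤ Submodule.span K {D F K z} from h trivial
    rw [← KaehlerDifferential.span_range_derivation, Submodule.span_le]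
    rintro _ ⟨a, rfl⟩
    obtain ⟨r, s, rfl⟩ := (IntermediateField.mem_adjoin_simple_iff E a).1
      (htop ▸ IntermediateField.mem_top)
    rw [SetLike.mem_coe, Derivation.leibniz_div, D_aeval_of_isAlgebraic, D_aeval_of_isAlgebraic]
    simp only [smul_smul, ← sub_smul]
    exact Submodule.smul_mem _ _ (Submodule.mem_span_singleton_self _)
  rw [eq_bot_iff]
  intro ω hω
  obtain ⟨g, rfl⟩ := hspan ω
  rw [Submodule.mem_bot]
  by_cases hdz : D F K z = 0
  · rw [hdz, smul_zero]
  -- the finite places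
  obtain ⟨p, hp⟩ : ∃ p : E[X], aeval z p = g := by
    let : Algebra E[X] K := (aeval z).toAlgebra
    have : IsScalarTower E E[X] K := .of_algebraMap_eq fun c =>
      show _ = aeval z (C c) by simp
    have := isFractionRing_aeval hz htop
    exact HeightOneSpectrum.mem_integers_of_valuation_le_one (R := E[X]) K g fun v =>
      valuation_le_one_of_mem_span v (aeval_X z) hdz
        (hω _ (mem_valuationSubring_of_algebraMap v))
  by_cases hp0 : p = 0
  · rw [← hp, hp0, map_zero, zero_smul]
  -- the place at infinity
  exfalso
  have hinv : D F K z = (-(z ^ 2)) • D F K z⁻¹ :=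
    Derivation.leibniz_of_mul_eq_one _ (mul_inv_cancel₀ hz0)
  have hzi : Transcendental E z⁻¹ := fun h => hz (by simpa using h.inv)
  have htopi : E⟮z⁻¹⟯ = ⊤ := by
    rw [eq_top_iff, ← htop, IntermediateField.adjoin_simple_le_iff]
    simpa using inv_mem (IntermediateField.mem_adjoin_simple_self E z⁻¹)
  let : Algebra E[X] K := (aeval z⁻¹).toAlgebra
  have : IsScalarTower E E[X] K := .of_algebraMap_eq fun c =>
    show _ = aeval z⁻¹ (C c) by simp
  have := isFractionRing_aeval hzi htopi
  have hdzi : D F K z⁻¹ ≠ 0 := fun h => hdz (by rw [hinv, h, smul_zero])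
  let v := idealX E
  have h1 : v.valuation K (g * -(z ^ 2)) ≤ 1 := by
    refine valuation_le_one_of_mem_span v (aeval_X z⁻¹) hdzi ?_
    rw [mul_smul, ← hinv]
    exact hω _ (mem_valuationSubring_of_algebraMap v)
  have hvz : v.valuation K z⁻¹ < 1 := by
    have := (v.valuation_lt_one_iff_mem (K := K) X).2 (by simp [v])
    have hX : aeval z⁻¹ (X : E[X]) = z⁻¹ := aeval_X _
    exact hX ▸ this
  have hrev : v.valuation K (aeval z⁻¹ p.reverse) = 1 := by
    refine (HeightOneSpectrum.valuation_eq_one_iff_notMem (K := K) v (r := p.reverse)).2 ?_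
    simp [v, Ideal.mem_span_singleton, X_dvd_iff, hp0]
  let := invertibleOfNonzero hz0
  have he := eval₂_reverse_mul_pow (algebraMap E K) z p
  rw [invOf_eq_inv, ← aeval_def, ← aeval_def, hp] at he
  have h2 : aeval z⁻¹ p.reverse = -(g * -(z ^ 2)) * z⁻¹ ^ (p.natDegree + 2) := by
    have h3 : z ^ (p.natDegree + 2) * z⁻¹ ^ (p.natDegree + 2) = 1 := by
      rw [← mul_pow, mul_inv_cancel₀ hz0, one_pow]
    rw [← he]
    linear_combination (-aeval z⁻¹ p.reverse) * h3
  rw [h2, map_mul, Valuation.map_neg, map_pow] at hrev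
  exact absurd hrev (mul_lt_one_of_nonneg_of_lt_one_right h1 zero_le
    (pow_lt_one₀ zero_le hvz (Nat.succ_ne_zero _))).ne

end Rational

/-! ### Quadratic extensions of a rational function field -/

section Quadratic

open Polynomial KaehlerDifferential

variable {F K : Type*} [Field F] [Field K] [Algebra F K]

theorem aeval_mem_valuationSubring {O : ValuationSubring K} (hO : ∀ c : F, algebraMap F K c ∈ O)
    {a : K} (ha : a ∈ O) (p : F[X]) : aeval a p ∈ O := by
  rw [aeval_eq_sum_range]
  refine sum_mem fun i _ => ?_
  rw [Algebra.smul_def]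
  exact mul_mem (hO _) (pow_mem ha _)

theorem mem_valuationSubring_of_sq_mem {O : ValuationSubring K} {a : K} (ha : a ^ 2 ∈ O) :
    a ∈ O := by
  rcases O.mem_or_inv_mem a with h | h
  · exact h
  by_cases h0 : a = 0
  · exact h0 ▸ O.zero_mem
  rw [show a = a ^ 2 * a⁻¹ by field_simp]
  exact mul_mem ha h

theorem two_smul_smul_D_of_sq_eq {u w : K} {S : F[X]} (h : u ^ 2 = aeval w S) :
    (2 * u) • D F K u = aeval w S.derivative • D F K w := by
  rw [← Derivation.map_aeval, ← h, Derivation.leibniz_pow, ← Nat.cast_smul_eq_nsmul K, smul_smul]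
  simp

/-- On `u ^ 2 = S(w)` with `S` squarefree of odd degree at least `3`, the differential `dw / u` is
regular. Where `w` is integral, write `1 = A S + B S'`: then `dw / u = A(w) u dw + 2 B(w) du`. Where
`w` has a pole, `z = w⁻¹` and `y = u z ^ (m + 1)` are integral, `y ^ 2 = R(z)` with
`R = X * S.reverse`, and `dw / u = - z ^ (m - 1) dz / y = - 2 z ^ (m - 1) dy / R'(z)`, where `R'(z)`
is a unit. -/
theorem inv_smul_D_mem_regularDifferentials [CharZero F] {u w : K} {S : F[X]} (hw0 : w ≠ 0)
    (hu0 : u ≠ 0) (h : u ^ 2 = aeval w S) (hS : Squarefree S) {m : ℕ} (hm : 1 ≤ m)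
    (hdeg : S.natDegree = 2 * m + 1) : u⁻¹ • D F K w ∈ regularDifferentials F K := by
  intro O hO
  have hD {a : K} (ha : a ∈ O) : D F K a ∈
      Submodule.span O ((fun a : K => D F K a) '' (O : Set K)) :=
    Submodule.subset_span ⟨a, ha, rfl⟩
  have hsmul {a : K} (ha : a ∈ O) {ω : Ω[K⁄F]}
      (hω : ω ∈ Submodule.span O ((fun a : K => D F K a) '' (O : Set K))) :
      a • ω ∈ Submodule.span O ((fun a : K => D F K a) '' (O : Set K)) :=
    Submodule.smul_mem _ (⟨a, ha⟩ : O) hω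
  by_cases hw : w ∈ O
  · have hu : u ∈ O := mem_valuationSubring_of_sq_mem (h ▸ aeval_mem_valuationSubring hO hw S)
    obtain ⟨A, B, hAB⟩ := PerfectField.separable_iff_squarefree.2 hS
    have hAB' := congrArg (aeval w) hAB
    rw [map_add, map_mul, map_mul, map_one, ← h] at hAB'
    have he : u⁻¹ • D F K w = (aeval w A * u) • D F K w + (aeval w B * 2) • D F K u := by
      have h1 : (aeval w B * 2) • D F K u = (u⁻¹ * (aeval w B * aeval w S.derivative)) • D F K w := by
        rw [← mul_assoc, mul_smul _ (aeval w S.derivative), ← two_smul_smul_D_of_sq_eq h, smul_smul]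
        congr 1
        field_simp
      rw [h1, ← add_smul]
      congr 1
      field_simp
      linear_combination -hAB'
    rw [he]
    refine add_mem (hsmul (mul_mem (aeval_mem_valuationSubring hO hw A) hu) (hD hw))
      (hsmul (mul_mem (aeval_mem_valuationSubring hO hw B) ?_) (hD hu))
    simp
  · have hz : w⁻¹ ∈ O := (O.mem_or_inv_mem w).resolve_left hw
    set z := w⁻¹ with hzdef
    have hz0 : z ≠ 0 := inv_ne_zero hw0
    let R : F[X] := X * S.reverse
    let y : K := u * z ^ (m + 1)
    have hy0 : y ≠ 0 := mul_ne_zero hu0 (pow_ne_zero _ hz0)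
    have hyR : y ^ 2 = aeval z R := by
      let := invertibleOfNonzero hw0
      have he := eval₂_reverse_mul_pow (algebraMap F K) w S
      rw [invOf_eq_inv, ← aeval_def, ← aeval_def, ← h, hdeg, ← hzdef] at he
      have hwz : w ^ (2 * m + 1) * z ^ (2 * m + 1) = 1 := by
        rw [← mul_pow, hzdef, mul_inv_cancel₀ hw0, one_pow]
      simp only [y, R, map_mul, aeval_X]
      linear_combination (-z ^ (2 * m + 2)) * he + (z * aeval z S.reverse) * hwz
    have hy : y ∈ O := mem_valuationSubring_of_sq_mem (hyR ▸ aeval_mem_valuationSubring hO hz R)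
    -- `R'(z)` is congruent to the nonzero constant `R'(0)` modulo the maximal ideal
    have hR0 : R.derivative.coeff 0 ≠ 0 := by
      simp only [R, derivative_mul, derivative_X, one_mul, coeff_add, mul_coeff_zero, coeff_X_zero,
        zero_mul, add_zero, coeff_zero_reverse]
      exact leadingCoeff_ne_zero.2 hS.ne_zero
    -- hence `R'(z)` is a unit of `O`
    have hval : 1 ≤ O.valuation (aeval z R.derivative) := by
      by_contra hlt
      have hdec : aeval z R.derivative =
          z * aeval z R.derivative.divX + algebraMap F K (R.derivative.coeff 0) := by
        conv_lhs => rw [← X_mul_divX_add R.derivative, map_add, map_mul, aeval_X, aeval_C]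
      have hvz : O.valuation z < 1 := by
        by_contra hge
        refine hw ((O.valuation_le_one_iff _).1 ?_)
        rw [← inv_inv w, map_inv₀]
        exact inv_le_one_of_one_le₀ (not_lt.1 hge)
      have h1 : O.valuation (z * aeval z R.derivative.divX) < 1 := by
        rw [map_mul]
        exact mul_lt_one_of_lt_of_le hvz
          ((O.valuation_le_one_iff _).2 (aeval_mem_valuationSubring hO hz _))
      have h2 : O.valuation (algebraMap F K (R.derivative.coeff 0)) < 1 := by
        rw [show algebraMap F K (R.derivative.coeff 0) =
          aeval z R.derivative - z * aeval z R.derivative.divX by rw [hdec]; ring]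
        exact (Valuation.map_sub _ _ _).trans_lt (max_lt (not_le.1 hlt) h1)
      have h3 : 1 ≤ O.valuation (algebraMap F K (R.derivative.coeff 0)) := by
        have := (O.valuation_le_one_iff _).2 (hO (R.derivative.coeff 0)⁻¹)
        rw [map_inv₀, map_inv₀] at this
        exact (inv_le_one₀ ((Valuation.pos_iff _).2 (by simpa using hR0))).1 this
      exact absurd h2 (not_lt.2 h3)
    have hunit : (aeval z R.derivative)⁻¹ ∈ O :=
      (O.valuation_le_one_iff _).1 (by rw [map_inv₀]; exact inv_le_one_of_one_le₀ hval)
    have hR1 : aeval z R.derivative ≠ 0 := fun h0 => by simp [h0] at hval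
    have hdz : D F K w = (-(w ^ 2)) • D F K z :=
      Derivation.leibniz_of_mul_eq_one _ (mul_inv_cancel₀ hw0)
    have hdz' : D F K z = ((aeval z R.derivative)⁻¹ * (2 * y)) • D F K y := by
      rw [mul_smul, two_smul_smul_D_of_sq_eq hyR, smul_smul, inv_mul_cancel₀ hR1, one_smul]
    have he : u⁻¹ • D F K w = (-2 * z ^ (m - 1) * (aeval z R.derivative)⁻¹) • D F K y := by
      rw [hdz, hdz', smul_smul, smul_smul]
      congr 1
      obtain ⟨k, rfl⟩ : ∃ k, m = k + 1 := ⟨m - 1, by omega⟩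
      have hwz : w * z = 1 := mul_inv_cancel₀ hw0
      simp only [y, Nat.add_sub_cancel]
      field_simp
      have : w ^ 2 * z ^ 2 = 1 := by rw [← mul_pow, hwz, one_pow]
      linear_combination (-2 * z ^ k) * this
    rw [he]
    refine hsmul (mul_mem (mul_mem ?_ (pow_mem hz _)) hunit) (hD hy)
    simp

theorem exists_squarefree_mul_sq {A : F[X]} (hA : A ≠ 0) :
    ∃ S C : F[X], Squarefree S ∧ A = S * C ^ 2 := by
  induction hn : A.natDegree using Nat.strong_induction_on generalizing A with
  | _ n ih =>
    by_cases hsq : Squarefree A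
    · exact ⟨A, 1, hsq, by simp⟩
    simp only [Squarefree, not_forall] at hsq
    obtain ⟨q, ⟨B, hB⟩, hq⟩ := hsq
    have hq0 : q ≠ 0 := fun h => hA (by simp [hB, h])
    have hB0 : B ≠ 0 := fun h => hA (by simp [hB, h])
    have hqd : 0 < q.natDegree :=
      Nat.pos_of_ne_zero fun h => hq (isUnit_iff_degree_eq_zero.2 (by
        rw [degree_eq_natDegree hq0, h]; rfl))
    have hd : A.natDegree = q.natDegree + q.natDegree + B.natDegree := by
      rw [hB, natDegree_mul (mul_ne_zero hq0 hq0) hB0, natDegree_mul hq0 hq0]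
    obtain ⟨S, C, hS, h⟩ := ih B.natDegree (by omega) hB0 rfl
    exact ⟨S, C * q, hS, by rw [hB, h]; ring⟩

/-- A curve `u ^ 2 = L(w)` with `L` of degree at most one has genus `0`: it is the line with
coordinate `u` when `L` is not constant, and otherwise the line with coordinate `w` over the finite
extension `F(u)` of `F`. -/
theorem regularDifferentials_eq_bot_of_sq_eq [CharZero F] {u w : K} {L : F[X]}
    (hw : Transcendental F w) (htop : F⟮u, w⟯ = ⊤) (hL : L.natDegree ≤ 1) (h : u ^ 2 = aeval w L) :
    regularDifferentials F K = ⊥ := by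
  obtain ⟨a, b, rfl⟩ := exists_eq_X_add_C_of_natDegree_le_one hL
  simp only [map_add, map_mul, aeval_C, aeval_X] at h
  by_cases ha : a = 0
  · rw [ha, map_zero, zero_mul, zero_add] at h
    have hu : IsAlgebraic F u := by
      refine IsAlgebraic.of_pow two_pos (h ▸ isAlgebraic_algebraMap b)
    have : Algebra.IsAlgebraic F F⟮u⟯ := IntermediateField.isAlgebraic_adjoin_simple hu.isIntegral
    refine regularDifferentials_eq_bot (E := F⟮u⟯) (z := w) (fun hal => hw ?_) ?_
    · exact hal.restrictScalars F
    · rw [← IntermediateField.restrictScalars_eq_top_iff (K := F),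
        IntermediateField.adjoin_simple_adjoin_simple, htop]
  · have hwu : w = (u ^ 2 - algebraMap F K b) / algebraMap F K a := by
      have : algebraMap F K a ≠ 0 := by simpa using ha
      field_simp
      linear_combination -h
    have hmem : w ∈ F⟮u⟯ := by
      rw [hwu]
      exact div_mem (sub_mem (pow_mem (IntermediateField.mem_adjoin_simple_self F u) _)
        (F⟮u⟯.algebraMap_mem b)) (F⟮u⟯.algebraMap_mem a)
    refine regularDifferentials_eq_bot (E := F) (z := u) (fun hal => hw ?_) ?_
    · rw [hwu, div_eq_mul_inv]
      exact ((hal.pow 2).sub (isAlgebraic_algebraMap b)).mul (isAlgebraic_algebraMap a).inv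
    · rw [eq_top_iff, ← htop, IntermediateField.adjoin_le_iff]
      rintro _ (rfl | rfl)
      · exact IntermediateField.mem_adjoin_simple_self F _
      · exact hmem

/-- On `v ^ 2 = L(w) C(w) ^ 2` the function `u = v / C(w)` satisfies `u ^ 2 = L(w)`. -/
theorem genus_eq_zero_of_eq_mul_sq [CharZero F] {v w : K} {L C : F[X]}
    (hw : Transcendental F w) (htop : F⟮v, w⟯ = ⊤) (hL : L.natDegree ≤ 1) (hC : C ≠ 0)
    (h : v ^ 2 = aeval w (L * C ^ 2)) : genus F K = 0 := by
  have hC0 : aeval w C ≠ 0 := fun h0 => hC ((transcendental_iff.1 hw) C h0)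
  rw [genus_eq_zero_iff]
  refine regularDifferentials_eq_bot_of_sq_eq (u := v / aeval w C) hw ?_ hL ?_
  · rw [eq_top_iff, ← htop, IntermediateField.adjoin_le_iff]
    have hwm : w ∈ F⟮v / aeval w C, w⟯ := IntermediateField.subset_adjoin F _ (by simp)
    rintro a (ha | ha)
    · have hv : v = v / aeval w C * aeval w C := (div_mul_cancel₀ v hC0).symm
      have hm := mul_mem (IntermediateField.subset_adjoin F {v / aeval w C, w} (Set.mem_insert _ _))
        (IntermediateField.aeval_coe F⟮v / aeval w C, w⟯ ⟨w, hwm⟩ C ▸ SetLike.coe_mem _)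
      rw [← hv] at hm
      rw [ha]
      exact hm
    · exact ha ▸ hwm
  · rw [div_pow, h, map_mul, map_pow, mul_div_cancel_right₀ _ (pow_ne_zero 2 hC0)]

/-- For `K = F(w, v)`, `v ^ 2 = A(w)` with `A` of odd degree: genus `0` forces the squarefree part of
`A` to be linear, since otherwise `C(w) dw / v` is a nonzero regular differential. -/
theorem exists_eq_mul_sq_of_genus_eq_zero [CharZero F] {v w : K} {A : F[X]}
    (hw : Transcendental F w) (htop : F⟮v, w⟯ = ⊤) (hA : Odd A.natDegree)
    (h : v ^ 2 = aeval w A) (hg : genus F K = 0) :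
    ∃ L C : F[X], L.natDegree = 1 ∧ A = L * C ^ 2 := by
  have hA0 : A ≠ 0 := fun h0 => by simp [h0] at hA
  obtain ⟨S, C, hS, rfl⟩ := exists_squarefree_mul_sq hA0
  have hC : C ≠ 0 := fun h0 => by simp [h0] at hA0
  have hC0 : aeval w C ≠ 0 := fun h0 => hC ((transcendental_iff.1 hw) C h0)
  have hS0 : aeval w S ≠ 0 := fun h0 => hS.ne_zero ((transcendental_iff.1 hw) S h0)
  rw [natDegree_mul hS.ne_zero (pow_ne_zero 2 hC), natDegree_pow, Nat.odd_add] at hA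
  obtain ⟨m, hm⟩ := hA.2 (even_two_mul _)
  refine ⟨S, C, ?_, rfl⟩
  by_contra hne
  have hu : (v / aeval w C) ^ 2 = aeval w S := by
    rw [div_pow, h, map_mul, map_pow, mul_div_cancel_right₀ _ (pow_ne_zero 2 hC0)]
  have hu0 : v / aeval w C ≠ 0 := fun h0 => hS0 (by rw [← hu, h0]; simp)
  have hw0 : w ≠ 0 := fun h0 => hw (h0 ▸ isAlgebraic_zero)
  have hmem := inv_smul_D_mem_regularDifferentials hw0 hu0 hu hS (by omega) hm
  rw [genus_eq_zero_iff.1 hg, Submodule.mem_bot] at hmem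
  have : Algebra.IsAlgebraic F⟮w⟯ K := by
    have hv : IsAlgebraic F⟮w⟯ v := by
      refine IsAlgebraic.of_pow two_pos ?_
      rw [h, show aeval w (S * C ^ 2) =
        algebraMap F⟮w⟯ K (aeval (IntermediateField.AdjoinSimple.gen F w) (S * C ^ 2)) by
          rw [← aeval_algebraMap_apply]; simp]
      exact isAlgebraic_algebraMap _
    have h1 := IntermediateField.isAlgebraic_adjoin_simple hv.isIntegral
    have h2 : IntermediateField.adjoin F⟮w⟯ {v} = ⊤ := by
      rw [← IntermediateField.restrictScalars_eq_top_iff (K := F),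
        IntermediateField.adjoin_simple_adjoin_simple, ← htop, Set.pair_comm]
    rw [h2] at h1
    exact ⟨fun a => (h1.isAlgebraic ⟨a, trivial⟩).algebraMap⟩
  exact smul_ne_zero (inv_ne_zero hu0) (D_ne_zero_of_transcendental hw) hmem

end Quadratic

/-! ### Consequences of the irreducibility of `f` -/

section CurvePoly

variable {F : Type*} [Field F] (φ ψ : Polynomial F)

/-- Restriction of a polynomial in `x, y` to the line `y = 0`. -/
def evalX : MvPolynomial (Fin 2) F →ₐ[F] Polynomial F :=
  MvPolynomial.aeval ![Polynomial.X, 0]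

/-- Restriction of a polynomial in `x, y` to the line `x = 0`. -/
def evalY : MvPolynomial (Fin 2) F →ₐ[F] Polynomial F :=
  MvPolynomial.aeval ![0, Polynomial.X]

theorem evalX_aeval_mul (p : Polynomial F) :
    evalX (Polynomial.aeval (MvPolynomial.X 0 * MvPolynomial.X 1) p) =
      Polynomial.C (p.coeff 0) := by
  rw [← Polynomial.aeval_algHom_apply]
  simp [evalX, Polynomial.aeval_def, Polynomial.eval₂_at_zero]

theorem evalY_aeval_mul (p : Polynomial F) :
    evalY (Polynomial.aeval (MvPolynomial.X 0 * MvPolynomial.X 1) p) =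
      Polynomial.C (p.coeff 0) := by
  rw [← Polynomial.aeval_algHom_apply]
  simp [evalY, Polynomial.aeval_def, Polynomial.eval₂_at_zero]

theorem natDegree_evalX_curvePoly : (evalX (curvePoly φ ψ)).natDegree = 14 := by
  simp only [curvePoly, map_add, map_sub, map_mul, map_pow, evalX_aeval_mul]
  simp only [evalX, MvPolynomial.aeval_X, Matrix.cons_val_zero, Matrix.cons_val_one]
  rw [zero_pow (by norm_num), zero_pow (by norm_num), sub_zero, add_zero]
  compute_degree!

theorem natDegree_evalY_curvePoly : (evalY (curvePoly φ ψ)).natDegree = 14 := by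
  simp only [curvePoly, map_add, map_sub, map_mul, map_pow, evalY_aeval_mul]
  simp only [evalY, MvPolynomial.aeval_X, Matrix.cons_val_zero, Matrix.cons_val_one]
  rw [zero_pow (by norm_num), zero_pow (by norm_num), zero_sub, zero_add]
  compute_degree!

theorem not_curvePoly_dvd_of_natDegree_evalX_lt {p : MvPolynomial (Fin 2) F} (h0 : evalX p ≠ 0)
    (h : (evalX p).natDegree < 14) : ¬ curvePoly φ ψ ∣ p := fun hd => by
  have := Polynomial.natDegree_le_of_dvd (map_dvd evalX hd) h0
  rw [natDegree_evalX_curvePoly] at this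
  omega

theorem not_curvePoly_dvd_of_natDegree_evalY_lt {p : MvPolynomial (Fin 2) F} (h0 : evalY p ≠ 0)
    (h : (evalY p).natDegree < 14) : ¬ curvePoly φ ψ ∣ p := fun hd => by
  have := Polynomial.natDegree_le_of_dvd (map_dvd evalY hd) h0
  rw [natDegree_evalY_curvePoly] at this
  omega

theorem not_isUnit_sub_add_aeval_mul (p : Polynomial F) :
    ¬ IsUnit (MvPolynomial.X 0 ^ 7 - MvPolynomial.X 1 ^ 7
      + Polynomial.aeval (MvPolynomial.X 0 * MvPolynomial.X 1) p : MvPolynomial (Fin 2) F) := by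
  intro h
  have h1 := Polynomial.natDegree_eq_zero_of_isUnit (h.map evalX)
  simp only [map_add, map_sub, map_pow, evalX_aeval_mul] at h1
  simp only [evalX, MvPolynomial.aeval_X, Matrix.cons_val_zero, Matrix.cons_val_one] at h1
  rw [zero_pow (by norm_num), sub_zero] at h1
  have h2 : (Polynomial.X ^ 7 + Polynomial.C (p.coeff 0) : Polynomial F).natDegree = 7 := by
    compute_degree!
  omega

/-- If the discriminant were a square `E ^ 2`, the quadratic `τ ^ 2 + τ ψ + φ + 2 w ^ 7` would have
the roots `(-ψ ± E) / 2`, and `f` would factor accordingly. -/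
theorem disc_ne_sq [CharZero F] (hf : Irreducible (curvePoly φ ψ)) (E : Polynomial F) :
    disc φ ψ ≠ E ^ 2 := by
  intro h
  have h2 : (Polynomial.C 2⁻¹ : Polynomial F) * 2 = 1 := by
    rw [show (2 : Polynomial F) = Polynomial.C 2 from rfl, ← Polynomial.C_mul,
      inv_mul_cancel₀ two_ne_zero, Polynomial.C_1]
  let p := Polynomial.C 2⁻¹ * (ψ + E)
  let q := Polynomial.C 2⁻¹ * (ψ - E)
  have hs : p + q = ψ := by linear_combination ψ * h2
  have hp : p * q = φ + 2 * Polynomial.X ^ 7 := by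
    rw [disc] at h
    linear_combination (Polynomial.C 2⁻¹ ^ 2) * h +
      (φ + 2 * Polynomial.X ^ 7) * (Polynomial.C 2⁻¹ * 2 + 1) * h2
  let xy : MvPolynomial (Fin 2) F := MvPolynomial.X 0 * MvPolynomial.X 1
  have hs' := congrArg (Polynomial.aeval xy) hs
  have hp' := congrArg (Polynomial.aeval xy) hp
  simp only [map_add, map_mul, map_pow, Polynomial.aeval_X, map_ofNat] at hs' hp'
  have hfac : curvePoly φ ψ =
      (MvPolynomial.X 0 ^ 7 - MvPolynomial.X 1 ^ 7 + Polynomial.aeval xy p) *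
      (MvPolynomial.X 0 ^ 7 - MvPolynomial.X 1 ^ 7 + Polynomial.aeval xy q) := by
    rw [curvePoly]
    linear_combination (MvPolynomial.X 1 ^ 7 - MvPolynomial.X 0 ^ 7) * hs' - hp'
  exact (hf.isUnit_or_isUnit hfac).elim (not_isUnit_sub_add_aeval_mul p)
    (not_isUnit_sub_add_aeval_mul q)

theorem natDegree_disc_le (hφ : φ.natDegree ≤ 7) (hψ : ψ.natDegree ≤ 3) :
    (disc φ ψ).natDegree ≤ 7 := by
  have h1 : (ψ ^ 2).natDegree ≤ 7 := by
    rw [Polynomial.natDegree_pow]; omega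
  have h2 : (4 * (φ + 2 * Polynomial.X ^ 7)).natDegree ≤ 7 := by
    compute_degree!
  exact (Polynomial.natDegree_sub_le _ _).trans (max_le h1 h2)

end CurvePoly

/-! ### Relations in the function field -/

section FunField

variable {F : Type*} [Field F] (φ ψ : Polynomial F)

theorem aeval_x_y (p : MvPolynomial (Fin 2) F) :
    MvPolynomial.aeval ![x φ ψ, y φ ψ] p =
      algebraMap (CoordRing φ ψ) (FunField φ ψ) (Ideal.Quotient.mk _ p) := by
  have h : MvPolynomial.aeval ![x φ ψ, y φ ψ] =
      (IsScalarTower.toAlgHom F (CoordRing φ ψ) (FunField φ ψ)).comp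
        (Ideal.Quotient.mkₐ F (Ideal.span {curvePoly φ ψ})) := by
    ext i
    fin_cases i <;> simp [x, y]
  rw [h]
  rfl

variable [hf : Fact (Irreducible (curvePoly φ ψ))]

theorem aeval_x_y_eq_zero_iff {p : MvPolynomial (Fin 2) F} :
    MvPolynomial.aeval ![x φ ψ, y φ ψ] p = 0 ↔ curvePoly φ ψ ∣ p := by
  rw [aeval_x_y, FaithfulSMul.algebraMap_eq_zero_iff, Ideal.Quotient.eq_zero_iff_mem,
    Ideal.mem_span_singleton]

theorem x_ne_zero : x φ ψ ≠ 0 := fun h =>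
  not_curvePoly_dvd_of_natDegree_evalX_lt φ ψ (p := MvPolynomial.X 0) (by simp [evalX])
    (by simp [evalX]) ((aeval_x_y_eq_zero_iff φ ψ).1 (by simp [h]))

theorem y_ne_zero : y φ ψ ≠ 0 := fun h =>
  not_curvePoly_dvd_of_natDegree_evalY_lt φ ψ (p := MvPolynomial.X 1) (by simp [evalY])
    (by simp [evalY]) ((aeval_x_y_eq_zero_iff φ ψ).1 (by simp [h]))

theorem x_pow_add_y_pow_ne_zero : x φ ψ ^ 7 + y φ ψ ^ 7 ≠ 0 := fun h =>
  not_curvePoly_dvd_of_natDegree_evalX_lt φ ψ (p := MvPolynomial.X 0 ^ 7 + MvPolynomial.X 1 ^ 7)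
    (by simp [evalX]) (by simp [evalX]) ((aeval_x_y_eq_zero_iff φ ψ).1 (by simp [h]))

theorem w_ne_zero : w φ ψ ≠ 0 := mul_ne_zero (x_ne_zero φ ψ) (y_ne_zero φ ψ)

theorem τ_relation : τ φ ψ ^ 2 + τ φ ψ * Polynomial.aeval (w φ ψ) ψ
    + Polynomial.aeval (w φ ψ) φ + 2 * w φ ψ ^ 7 = 0 := by
  have h := (aeval_x_y_eq_zero_iff φ ψ).2 (dvd_refl (curvePoly φ ψ))
  simp only [curvePoly, map_add, map_sub, map_mul, map_pow, ← Polynomial.aeval_algHom_apply,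
    MvPolynomial.aeval_X, Matrix.cons_val_zero, Matrix.cons_val_one] at h
  change _ + Polynomial.aeval (w φ ψ) φ + _ * Polynomial.aeval (w φ ψ) ψ = 0 at h
  simp only [τ]
  have h7 : w φ ψ ^ 7 = x φ ψ ^ 7 * y φ ψ ^ 7 := by rw [w, mul_pow]
  linear_combination h + 2 * h7

/-- The function `w` is nonconstant: a polynomial `p` with `p(0) ≠ 0` and `p(w) = 0` would give a
multiple `p(xy)` of `f` with nonzero constant restriction to the line `y = 0`. -/
theorem transcendental_w : Transcendental F (w φ ψ) := by
  rw [transcendental_iff]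
  intro p hp
  by_contra hp0
  obtain ⟨q, hpq, hq⟩ := p.exists_eq_pow_rootMultiplicity_mul_and_not_dvd hp0 0
  rw [Polynomial.C_0, sub_zero] at hpq hq
  rw [hpq, map_mul, map_pow, Polynomial.aeval_X] at hp
  have hq0 := (mul_eq_zero.1 hp).resolve_left (pow_ne_zero _ (w_ne_zero φ ψ))
  have hc : q.coeff 0 ≠ 0 := fun h => hq (Polynomial.X_dvd_iff.2 h)
  refine not_curvePoly_dvd_of_natDegree_evalX_lt φ ψ
    (p := Polynomial.aeval (MvPolynomial.X 0 * MvPolynomial.X 1) q)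
    (by simpa [evalX_aeval_mul] using hc) (by simp [evalX_aeval_mul])
    ((aeval_x_y_eq_zero_iff φ ψ).1 ?_)
  rw [← Polynomial.aeval_algHom_apply]
  simpa [w] using hq0

/-- The square root `2 τ + ψ(w)` of the discriminant. -/
def sqrtDisc : FunField φ ψ := 2 * τ φ ψ + Polynomial.aeval (w φ ψ) ψ

theorem sqrtDisc_sq : sqrtDisc φ ψ ^ 2 = Polynomial.aeval (w φ ψ) (disc φ ψ) := by
  simp only [sqrtDisc, disc, map_sub, map_mul, map_add, map_pow, map_ofNat, Polynomial.aeval_X]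
  linear_combination 4 * τ_relation φ ψ

/-- `1` and `τ` are linearly independent over `F(w)`, because the discriminant is not a square. -/
theorem eq_zero_of_aeval_add_aeval_mul_τ [CharZero F] {c d : Polynomial F}
    (h : Polynomial.aeval (w φ ψ) c + Polynomial.aeval (w φ ψ) d * τ φ ψ = 0) :
    c = 0 ∧ d = 0 := by
  have hinj := transcendental_iff_injective.1 (transcendental_w φ ψ)
  have hsq : (2 * c - d * ψ) ^ 2 = d ^ 2 * disc φ ψ := by
    apply hinj
    rw [map_mul, map_pow, map_pow, ← sqrtDisc_sq]
    simp only [map_sub, map_mul, map_ofNat, sqrtDisc]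
    linear_combination 4 * (Polynomial.aeval (w φ ψ) c
      - Polynomial.aeval (w φ ψ) d * (τ φ ψ + Polynomial.aeval (w φ ψ) ψ)) * h
  have hd : d = 0 := by
    by_contra hd
    obtain ⟨E, hE⟩ := (IsIntegrallyClosed.pow_dvd_pow_iff two_ne_zero).1 (Dvd.intro _ hsq.symm)
    refine disc_ne_sq φ ψ hf.out E (mul_left_cancel₀ (pow_ne_zero 2 hd) ?_)
    rw [← hsq, hE, mul_pow]
  refine ⟨hinj ?_, hd⟩
  simpa [hd] using h

/-- The ideal of relations between `τ` and `w`: division by the monic quadratic in `τ` leaves a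
remainder `c(w) + d(w) τ`, which vanishes only if `c = d = 0`. -/
theorem ker_aeval_τ_w [CharZero F] :
    RingHom.ker (MvPolynomial.aeval (R := F) ![τ φ ψ, w φ ψ]) =
      Ideal.span {MvPolynomial.X 0 ^ 2 + MvPolynomial.X 0 * Polynomial.aeval (MvPolynomial.X 1) ψ
        + Polynomial.aeval (MvPolynomial.X 1) φ + 2 * MvPolynomial.X 1 ^ 7} := by
  have hG : MvPolynomial.aeval (R := F) ![τ φ ψ, w φ ψ]
      (MvPolynomial.X 0 ^ 2 + MvPolynomial.X 0 * Polynomial.aeval (MvPolynomial.X 1) ψ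
        + Polynomial.aeval (MvPolynomial.X 1) φ + 2 * MvPolynomial.X 1 ^ 7) = 0 := by
    simp only [map_add, map_mul, map_pow, ← Polynomial.aeval_algHom_apply, map_ofNat,
      MvPolynomial.aeval_X, Matrix.cons_val_zero, Matrix.cons_val_one]
    exact τ_relation φ ψ
  apply le_antisymm
  · intro p hp
    rw [Ideal.mem_span_singleton]
    have hdiv (p : MvPolynomial (Fin 2) F) : ∃ (c d : Polynomial F) (q : MvPolynomial (Fin 2) F),
        p = Polynomial.aeval (MvPolynomial.X 1) c
          + Polynomial.aeval (MvPolynomial.X 1) d * MvPolynomial.X 0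
          + (MvPolynomial.X 0 ^ 2 + MvPolynomial.X 0 * Polynomial.aeval (MvPolynomial.X 1) ψ
            + Polynomial.aeval (MvPolynomial.X 1) φ + 2 * MvPolynomial.X 1 ^ 7) * q := by
      induction p using MvPolynomial.induction_on with
      | C a => exact ⟨Polynomial.C a, 0, 0, by simp [MvPolynomial.algebraMap_eq]⟩
      | add p q hp hq =>
        obtain ⟨c, d, r, rfl⟩ := hp
        obtain ⟨c', d', r', rfl⟩ := hq
        exact ⟨c + c', d + d', r + r', by simp only [map_add]; ring⟩
      | mul_X p i hp =>
        obtain ⟨c, d, r, rfl⟩ := hp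
        fin_cases i
        · refine ⟨-d * (φ + 2 * Polynomial.X ^ 7), c - d * ψ,
            r * MvPolynomial.X 0 + Polynomial.aeval (MvPolynomial.X 1) d, ?_⟩
          simp only [map_add, map_sub, map_neg, map_mul, map_pow, map_ofNat, Polynomial.aeval_X,
            Fin.zero_eta]
          ring
        · refine ⟨c * Polynomial.X, d * Polynomial.X, r * MvPolynomial.X 1, ?_⟩
          simp only [map_mul, Polynomial.aeval_X, Fin.mk_one]
          ring
    obtain ⟨c, d, q, rfl⟩ := hdiv p
    rw [RingHom.mem_ker, map_add, map_mul _ _ q, hG, zero_mul, add_zero, map_add, map_mul,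
      ← Polynomial.aeval_algHom_apply, ← Polynomial.aeval_algHom_apply] at hp
    obtain ⟨rfl, rfl⟩ := eq_zero_of_aeval_add_aeval_mul_τ φ ψ (by simpa using hp)
    simp
  · rw [Ideal.span_singleton_le_iff_mem, RingHom.mem_ker]
    exact hG

end FunField

/-! ### The fixed field of the dihedral group -/

section FixedField

variable {F : Type*} [Field F] (φ ψ : Polynomial F) [hf : Fact (Irreducible (curvePoly φ ψ))]

theorem adjoin_x_y : F⟮x φ ψ, y φ ψ⟯ = ⊤ := by
  rw [eq_top_iff]
  intro a _
  have hmem (b : CoordRing φ ψ) : algebraMap _ (FunField φ ψ) b ∈ F⟮x φ ψ, y φ ψ⟯ := by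
    obtain ⟨p, rfl⟩ := Ideal.Quotient.mk_surjective b
    rw [← aeval_x_y]
    induction p using MvPolynomial.induction_on with
    | C c => simp
    | add p q hp hq => rw [map_add]; exact add_mem hp hq
    | mul_X p i hp =>
      rw [map_mul, MvPolynomial.aeval_X]
      refine mul_mem hp (IntermediateField.subset_adjoin F _ ?_)
      fin_cases i <;> simp
  obtain ⟨b, c, -, rfl⟩ := IsFractionRing.div_surjective (CoordRing φ ψ) a
  exact div_mem (hmem b) (hmem c)

theorem inducedAut_aeval_x_y {e : MvPolynomial (Fin 2) F ≃ₐ[F] MvPolynomial (Fin 2) F}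
    (he : e (curvePoly φ ψ) = curvePoly φ ψ) (p : MvPolynomial (Fin 2) F) :
    inducedAut φ ψ e he (MvPolynomial.aeval ![x φ ψ, y φ ψ] p) =
      MvPolynomial.aeval ![x φ ψ, y φ ψ] (e p) := by
  rw [aeval_x_y, aeval_x_y, inducedAut, IsFractionRing.fieldEquivOfAlgEquiv_algebraMap,
    Ideal.quotientEquivAlg_mk]

variable {ζ : F} (hζ : IsPrimitiveRoot ζ 7)

theorem autS_x : autS φ ψ hζ (x φ ψ) = algebraMap F _ ζ * x φ ψ := by
  have h := inducedAut_aeval_x_y φ ψ (polyS_curvePoly φ ψ hζ) (MvPolynomial.X 0)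
  simpa [polyS, autS] using h

theorem autS_y : autS φ ψ hζ (y φ ψ) = algebraMap F _ ζ⁻¹ * y φ ψ := by
  have h := inducedAut_aeval_x_y φ ψ (polyS_curvePoly φ ψ hζ) (MvPolynomial.X 1)
  simpa [polyS, autS] using h

theorem autT_x : autT φ ψ (x φ ψ) = -y φ ψ := by
  have h := inducedAut_aeval_x_y φ ψ (polyT_curvePoly φ ψ) (MvPolynomial.X 0)
  simpa [polyT, autT] using h

theorem autT_y : autT φ ψ (y φ ψ) = -x φ ψ := by
  have h := inducedAut_aeval_x_y φ ψ (polyT_curvePoly φ ψ) (MvPolynomial.X 1)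
  simpa [polyT, autT] using h

theorem adjoin_τ_w_le_quotientField : F⟮τ φ ψ, w φ ψ⟯ ≤ quotientField φ ψ hζ := by
  have h7 : algebraMap F (FunField φ ψ) ζ ^ 7 = 1 := by rw [← map_pow, hζ.pow_eq_one, map_one]
  have h0 : algebraMap F (FunField φ ψ) ζ ≠ 0 := by
    simpa using hζ.ne_zero (by norm_num)
  rw [quotientField, IntermediateField.le_iff_le, D₇, Subgroup.closure_le]
  rintro σ hσ
  rw [SetLike.mem_coe, IntermediateField.mem_fixingSubgroup_iff]
  refine (IntermediateField.forall_mem_adjoin_smul_eq_self_iff (S := {τ φ ψ, w φ ψ}) F σ).2 ?_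
  rcases hσ with rfl | rfl
  · rintro _ (rfl | rfl)
    · simp [AlgEquiv.smul_def, τ, autS_x, autS_y, mul_pow, h7]
    · simp only [AlgEquiv.smul_def, w, map_mul, autS_x, autS_y, map_inv₀]
      field_simp
  · rintro _ (rfl | rfl)
    · simp only [AlgEquiv.smul_def, τ, map_sub, map_pow, autT_x, autT_y]
      ring
    · simp only [AlgEquiv.smul_def, w, map_mul, autT_x, autT_y]
      ring

section Degree

variable {N : IntermediateField F (FunField φ ψ)}

/-- `x` is a root of `Z ^ 14 - τ Z ^ 7 - w ^ 7`. -/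
theorem exists_monic_aeval_x_eq_zero (hτ : τ φ ψ ∈ N) (hw : w φ ψ ∈ N) :
    ∃ P : Polynomial N, P.Monic ∧ P.natDegree = 14 ∧ Polynomial.aeval (x φ ψ) P = 0 := by
  refine ⟨Polynomial.X ^ 14 - Polynomial.C ⟨τ φ ψ, hτ⟩ * Polynomial.X ^ 7
    - Polynomial.C (⟨w φ ψ, hw⟩ ^ 7), by monicity!, by compute_degree!, ?_⟩
  simp only [map_sub, map_mul, map_pow, Polynomial.aeval_X, Polynomial.aeval_C,
    IntermediateField.algebraMap_apply, τ, w]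
  ring

theorem adjoin_simple_x (hw : w φ ψ ∈ N) : IntermediateField.adjoin N {x φ ψ} = ⊤ := by
  rw [← IntermediateField.restrictScalars_eq_top_iff (K := F), eq_top_iff, ← adjoin_x_y φ ψ,
    IntermediateField.adjoin_le_iff]
  have hx : x φ ψ ∈ IntermediateField.adjoin N {x φ ψ} :=
    IntermediateField.mem_adjoin_simple_self N _
  rintro a (ha | ha)
  · exact ha ▸ hx
  · have : y φ ψ = w φ ψ / x φ ψ := by rw [w, mul_div_cancel_left₀ _ (x_ne_zero φ ψ)]
    rw [ha, this]
    exact div_mem ((IntermediateField.adjoin N {x φ ψ}).algebraMap_mem ⟨_, hw⟩) hx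

theorem finiteDimensional_funField (hτ : τ φ ψ ∈ N) (hw : w φ ψ ∈ N) : FiniteDimensional N (FunField φ ψ) := by
  obtain ⟨P, hP, -, h0⟩ := exists_monic_aeval_x_eq_zero φ ψ hτ hw
  have := IntermediateField.adjoin.finiteDimensional (K := N) (x := x φ ψ) ⟨P, hP, h0⟩
  rw [adjoin_simple_x φ ψ hw] at this
  exact IntermediateField.topEquiv.toLinearEquiv.finiteDimensional

theorem finrank_funField_eq (hτ : τ φ ψ ∈ N) (hw : w φ ψ ∈ N) :
    Module.finrank N (FunField φ ψ) = (minpoly N (x φ ψ)).natDegree := by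
  have := finiteDimensional_funField φ ψ hτ hw
  exact ((Field.primitive_element_iff_minpoly_natDegree_eq N _).1
    (adjoin_simple_x φ ψ hw)).symm

theorem finrank_funField_le (hτ : τ φ ψ ∈ N) (hw : w φ ψ ∈ N) : Module.finrank N (FunField φ ψ) ≤ 14 := by
  obtain ⟨P, hP, hdeg, h0⟩ := exists_monic_aeval_x_eq_zero φ ψ hτ hw
  rw [finrank_funField_eq φ ψ hτ hw, ← hdeg]
  exact Polynomial.natDegree_le_natDegree (minpoly.min N _ hP h0)

end Degree

/-- Automorphisms in `H` permute the roots of a polynomial over the fixed field of `H`. -/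
theorem aeval_apply_eq_zero_of_mem {F K : Type*} [Field F] [Field K] [Algebra F K]
    {H : Subgroup (K ≃ₐ[F] K)} {σ : K ≃ₐ[F] K} (hσ : σ ∈ H)
    {P : Polynomial (IntermediateField.fixedField H)} {a : K} (ha : Polynomial.aeval a P = 0) :
    Polynomial.aeval (σ a) P = 0 := by
  have h := congrArg (σ : K →+* K) ha
  rw [map_zero, Polynomial.aeval_def, Polynomial.hom_eval₂] at h
  have hc : (σ : K →+* K).comp (algebraMap (IntermediateField.fixedField H) K) =
      algebraMap (IntermediateField.fixedField H) K :=
    RingHom.ext fun c => (IntermediateField.mem_fixedField_iff H _).1 c.2 σ hσ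
  rwa [hc] at h

theorem fourteen_le_natDegree_of_isRoot {K : Type*} [Field K] {z x y : K}
    (hz : IsPrimitiveRoot z 7) (hx0 : x ≠ 0) (hy0 : y ≠ 0) (hxy : x ^ 7 + y ^ 7 ≠ 0)
    {P : Polynomial K} (hP : P ≠ 0) (hx : ∀ i : ℕ, P.IsRoot (z ^ i * x))
    (hy : ∀ i : ℕ, P.IsRoot (-(z ^ i * y))) : 14 ≤ P.natDegree := by
  classical
  let A := (Finset.range 7).image fun i => z ^ i * x
  let B := (Finset.range 7).image fun i => -(z ^ i * y)
  have hA : A.card = 7 := by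
    rw [Finset.card_image_of_injOn, Finset.card_range]
    intro i hi j hj hij
    exact hz.pow_inj (Finset.mem_range.1 hi) (Finset.mem_range.1 hj) (mul_right_cancel₀ hx0 hij)
  have hB : B.card = 7 := by
    rw [Finset.card_image_of_injOn, Finset.card_range]
    intro i hi j hj hij
    exact hz.pow_inj (Finset.mem_range.1 hi) (Finset.mem_range.1 hj)
      (mul_right_cancel₀ hy0 (neg_injective hij))
  -- a common element would give `x ^ 7 = - y ^ 7`
  have hAB : Disjoint A B := by
    rw [Finset.disjoint_left]
    rintro a ha hb
    obtain ⟨i, -, rfl⟩ := Finset.mem_image.1 ha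
    obtain ⟨j, -, hj⟩ := Finset.mem_image.1 hb
    have h7 (k : ℕ) : (z ^ k) ^ 7 = 1 := by rw [← pow_mul, mul_comm, pow_mul, hz.pow_eq_one, one_pow]
    have h := congrArg (· ^ 7) hj
    simp only [Odd.neg_pow (by decide : Odd 7), mul_pow, h7, one_mul] at h
    exact hxy (by rw [← h, neg_add_cancel])
  have hroots : (A ∪ B).val ⊆ P.roots := by
    intro a ha
    rw [Polynomial.mem_roots hP]
    rw [Finset.mem_val, Finset.mem_union] at ha
    rcases ha with ha | ha
    · obtain ⟨i, -, rfl⟩ := Finset.mem_image.1 ha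
      exact hx i
    · obtain ⟨i, -, rfl⟩ := Finset.mem_image.1 ha
      exact hy i
  have h := Polynomial.card_le_degree_of_subset_roots hroots
  rwa [Finset.card_union_of_disjoint hAB, hA, hB] at h

/-- The `14` conjugates `ζ ^ i x` and `- ζ ^ i y` of `x` are distinct, so `x` has degree at least
`14` over the fixed field. -/
theorem fourteen_le_natDegree_minpoly :
    14 ≤ (minpoly (quotientField φ ψ hζ) (x φ ψ)).natDegree := by
  have hle := adjoin_τ_w_le_quotientField φ ψ hζ
  have := finiteDimensional_funField φ ψ
    (hle (IntermediateField.subset_adjoin F _ (Set.mem_insert _ _)))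
    (hle (IntermediateField.subset_adjoin F _ (Set.mem_insert_of_mem _ rfl)))
  set P := minpoly (quotientField φ ψ hζ) (x φ ψ)
  have hP0 : P ≠ 0 := minpoly.ne_zero (Algebra.IsIntegral.isIntegral _)
  let z := algebraMap F (FunField φ ψ) ζ
  have hz : IsPrimitiveRoot z 7 := hζ.map_of_injective (algebraMap F (FunField φ ψ)).injective
  have hx0 := x_ne_zero φ ψ
  have hy0 := y_ne_zero φ ψ
  have hx (i : ℕ) : Polynomial.aeval (z ^ i * x φ ψ) P = 0 := by
    induction i with
    | zero => rw [pow_zero, one_mul]; exact minpoly.aeval _ _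
    | succ i ih =>
      have h := aeval_apply_eq_zero_of_mem
        (Subgroup.subset_closure (Set.mem_insert _ _) : autS φ ψ hζ ∈ D₇ φ ψ hζ) ih
      rw [map_mul, map_pow, AlgEquiv.commutes, autS_x, ← mul_assoc, ← pow_succ] at h
      exact h
  have hy (i : ℕ) : Polynomial.aeval (-(z ^ i * y φ ψ)) P = 0 := by
    have h := aeval_apply_eq_zero_of_mem
      (Subgroup.subset_closure (Set.mem_insert_of_mem _ rfl) : autT φ ψ ∈ D₇ φ ψ hζ) (hx i)
    rw [map_mul, map_pow, AlgEquiv.commutes, autT_x, mul_neg] at h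
    exact h
  have h7 := x_pow_add_y_pow_ne_zero φ ψ
  have hmap (a : FunField φ ψ) (ha : Polynomial.aeval a P = 0) :
      (P.map (algebraMap _ (FunField φ ψ))).IsRoot a := by
    rw [Polynomial.IsRoot, Polynomial.eval_map_algebraMap, ha]
  -- count the roots of the minimal polynomial in `K`
  rw [← Polynomial.natDegree_map (algebraMap (quotientField φ ψ hζ) (FunField φ ψ))]
  exact fourteen_le_natDegree_of_isRoot hz hx0 hy0 h7
    (Polynomial.map_ne_zero hP0)
    (fun i => hmap _ (hx i)) fun i => hmap _ (hy i)

theorem quotientField_eq_adjoin :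
    quotientField φ ψ hζ = F⟮τ φ ψ, w φ ψ⟯ := by
  have hle := adjoin_τ_w_le_quotientField φ ψ hζ
  have hτ : τ φ ψ ∈ F⟮τ φ ψ, w φ ψ⟯ := IntermediateField.subset_adjoin F _ (by simp)
  have hw : w φ ψ ∈ F⟮τ φ ψ, w φ ψ⟯ := IntermediateField.subset_adjoin F _ (by simp)
  have := finiteDimensional_funField φ ψ hτ hw
  refine (IntermediateField.eq_of_le_of_finrank_le' hle ?_).symm
  rw [finrank_funField_eq φ ψ (hle hτ) (hle hw)]
  exact (finrank_funField_le φ ψ hτ hw).trans (fourteen_le_natDegree_minpoly φ ψ hζ)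

end FixedField

end DihedralCurve

end

theorem propositionP {F : Type*} [Field F] [CharZero F] (φ ψ : Polynomial F)
    (hφ : φ.natDegree ≤ 7) (hψ : ψ.natDegree ≤ 3)
    [hf : Fact (Irreducible (DihedralCurve.curvePoly φ ψ))] :
    (∀ (ζ : F) (hζ : IsPrimitiveRoot ζ 7),
      DihedralCurve.quotientField φ ψ hζ = F⟮DihedralCurve.τ φ ψ, DihedralCurve.w φ ψ⟯) ∧
    RingHom.ker (MvPolynomial.aeval (R := F) ![DihedralCurve.τ φ ψ, DihedralCurve.w φ ψ]) =
      Ideal.span {MvPolynomial.X 0 ^ 2 + MvPolynomial.X 0 * Polynomial.aeval (MvPolynomial.X 1) ψ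
        + Polynomial.aeval (MvPolynomial.X 1) φ + 2 * MvPolynomial.X 1 ^ 7} ∧
    ((∃ L C : Polynomial F, L.natDegree ≤ 1 ∧ C.natDegree ≤ 3 ∧
        DihedralCurve.disc φ ψ = L * C ^ 2) →
      DihedralCurve.genus F F⟮DihedralCurve.τ φ ψ, DihedralCurve.w φ ψ⟯ = 0) ∧
    (Odd (DihedralCurve.disc φ ψ).natDegree →
      DihedralCurve.genus F F⟮DihedralCurve.τ φ ψ, DihedralCurve.w φ ψ⟯ = 0 →
      ∃ L C : Polynomial F, L.natDegree ≤ 1 ∧ C.natDegree ≤ 3 ∧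
        DihedralCurve.disc φ ψ = L * C ^ 2) := by
  open DihedralCurve in
  let M := F⟮τ φ ψ, w φ ψ⟯
  let w' : M := ⟨w φ ψ, IntermediateField.subset_adjoin F _ (by simp)⟩
  let τ' : M := ⟨τ φ ψ, IntermediateField.subset_adjoin F _ (by simp)⟩
  let v' : M := 2 * τ' + Polynomial.aeval w' ψ
  have hcoe (p : Polynomial F) : ((Polynomial.aeval w' p : M) : FunField φ ψ) =
      Polynomial.aeval (w φ ψ) p := (IntermediateField.aeval_coe M w' p).symm
  have hw : Transcendental F w' := by
    rw [transcendental_iff]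
    intro p hp
    exact transcendental_iff.1 (transcendental_w φ ψ) p (by rw [← hcoe, hp]; rfl)
  have hv : v' ^ 2 = Polynomial.aeval w' (disc φ ψ) := by
    apply Subtype.ext
    rw [hcoe, ← sqrtDisc_sq, sqrtDisc, ← hcoe ψ]
    rfl
  have htop : F⟮v', w'⟯ = ⊤ := by
    have hwm : w' ∈ F⟮v', w'⟯ := IntermediateField.subset_adjoin F _ (by simp)
    have hvm : v' ∈ F⟮v', w'⟯ := IntermediateField.subset_adjoin F _ (by simp)
    have hψm : Polynomial.aeval w' ψ ∈ F⟮v', w'⟯ :=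
      IntermediateField.aeval_coe F⟮v', w'⟯ ⟨w', hwm⟩ ψ ▸ SetLike.coe_mem _
    have hτm : τ' ∈ F⟮v', w'⟯ := by
      have : τ' = (v' - Polynomial.aeval w' ψ) / 2 := by
        simp only [v']
        ring
      rw [this]
      exact div_mem (sub_mem hvm hψm) (ofNat_mem _ 2)
    have h : F⟮τ', w'⟯ = ⊤ := by
      apply IntermediateField.lift_injective M
      rw [IntermediateField.lift_adjoin, IntermediateField.lift_top, Set.image_pair]
    rw [eq_top_iff, ← h, IntermediateField.adjoin_le_iff]
    rintro a (ha | ha)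
    · exact ha ▸ hτm
    · exact ha ▸ hwm
  refine ⟨fun ζ hζ => quotientField_eq_adjoin φ ψ hζ, ker_aeval_τ_w φ ψ, ?_, ?_⟩
  · rintro ⟨L, C, hL, -, h⟩
    have hC : C ≠ 0 := fun hC => disc_ne_sq φ ψ hf.out 0 (by rw [h, hC]; simp)
    exact genus_eq_zero_of_eq_mul_sq hw htop hL hC (h ▸ hv)
  · intro hodd hg
    obtain ⟨L, C, hL, h⟩ := exists_eq_mul_sq_of_genus_eq_zero hw htop hodd hv hg
    refine ⟨L, C, hL.le, ?_, h⟩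
    have hdeg := natDegree_disc_le φ ψ hφ hψ
    by_cases hC : C = 0
    · simp [hC]
    have hL0 : L ≠ 0 := fun h0 => by simp [h0] at hL
    rw [h, Polynomial.natDegree_mul hL0 (pow_ne_zero 2 hC), Polynomial.natDegree_pow, hL] at hdeg
    omega
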